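/- Let $(\Theta,\nu)$ be a measure space and $T:\Theta\to\mathbb R^d$ a measurable statistic. Let $S(\theta)=(1,T(\theta))\in\mathbb R^{1+d}$ be the augmented statistic, and assume that the family is minimal: the functions $1,T_1,\dots,T_d$ are linearly independent modulo $\nu$-null sets. Work with unnormalised exponential-family densities $e^{\eta^\top S(\theta)}$, where the augmented natural parameter is $\eta=(c,\tilde\eta)\in\mathbb R\times\mathbb R^d$. Write $p(y_k\mid\theta)$ for the likelihood of the $k$-th data partition (measurable in $\theta$ and positive for $\nu$-almost every $\theta$), $q=e^{\eta_q^\top S}$ for the current approximate posterior, and $t_k=e^{\eta_k^\top S}$ for the current approximate likelihood. For $\alpha>0$ and damping $\rho$, one step of power EP (PEP) is the following. 1. Tilted distribution: $\hat p_\alpha(\theta)=q(\theta)\,\bigl(p(y_k\mid\theta)/t_k(\theta)\bigr)^{\alpha}$. 2. Moment matching: $q_\alpha=\mathrm{proj}(\hat p_\alpha)=e^{\eta_\alpha^\top S}$, where $\int q_\alpha S\,d\nu=\int \hat p_\alpha S\,d\nu$. 3. Damped update of the posterior: $q_\alpha^{\rm new}=q^{\,1-\rho/\alpha}\,q_\alpha^{\,\rho/\alpha}$.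 4. Update of the approximate likelihood: $t_{k,\alpha}^{\rm new}=\dfrac{q_\alpha^{\rm new}}{q}\,t_k$. Let $\mu_q=\int qS\,d\nu$ be the mean parameter of $q$. Let $\bar q$ be the normalised version of $q$ (the exponential-family distribution with natural parameter $\tilde\eta_q$), with mean parameter $\mu_{\bar q}=\mathbb E_{\bar q}[T]$. Assume that * $\tilde\eta_q$ is an interior point of the natural parameter space $\{\tilde\eta:\int e^{\tilde\eta^\top T}d\nu<\infty\}$; * $\int e^{\tilde\eta^\top T}\,|\log p(y_k\mid\theta)|\,d\nu<\infty$ for all $\tilde\eta$ in a neighbourhood of $\tilde\eta_q$; * $\int\hat p_{\alpha_0}\,d\nu<\infty$ for some $\alpha_0>0$. Then for every $\rho\in\mathbb R$ (in particular every $\rho\in(0,1]$) the following hold. * For all sufficiently small $\alpha>0$ the PEP step is well defined: there is exactly one pair of augmented natural parameters $(\eta_{q,\alpha}^{\rm new},\eta_{k,\alpha}^{\rm new})$ for which $q_\alpha^{\rm new}=e^{(\eta_{q,\alpha}^{\rm new})^\top S}$ and $t_{k,\alpha}^{\rm new}=e^{(\eta_{k,\alpha}^{\rm new})^\top S}$ are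 the result of the step. * The function $\mu\mapsto\int q\log p(y_k\mid\theta)\,d\nu$, where $q$ is the unnormalised member with mean parameter $\mu$, is differentiable at $\mu_q$. Likewise $m\mapsto\mathbb E_{\bar q}[\log p(y_k\mid\theta)]$, where $\bar q$ is the normalised member with mean parameter $m$, is differentiable at $\mu_{\bar q}$. * As $\alpha\to0^+$ the PEP step becomes exactly the damped local-VI fixed-point update. In the augmented natural parameters, $$\eta_{k,\alpha}^{\rm new}\longrightarrow \eta_k^{\rm new}:=(1-\rho)\,\eta_k+\rho\,\frac{\mathrm d}{\mathrm d\mu_q}\int q\,\log p(y_k\mid\theta)\,d\nu,\qquad \eta_{q,\alpha}^{\rm new}\longrightarrow \eta_q-\eta_k+\eta_k^{\rm new}.$$ In the natural parameters proper (without the component belonging to the constant statistic $1$), with the normalised $\bar q$, $$\tilde\eta_{k,\alpha}^{\rm new}\longrightarrow \tilde\eta_k^{\rm new}:=(1-\rho)\,\tilde\eta_k+\rho\,\frac{\mathrm d}{\mathrm d\mu_{\bar q}}\mathbb E_{\bar q}[\log p(y_k\mid\theta)],\qquad \tilde\eta_{q,\alpha}^{\rm new}\longrightarrow \tilde\eta_q-\tilde\eta_k+\tilde\eta_k^{\rm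 new}.$$ For $\rho=1$ this is the undamped update $\eta_k=\frac{\mathrm d}{\mathrm d\mu_q}\mathbb E_q[\log p(y_k\mid\theta)]$. -/

import Mathlib

open MeasureTheory Filter Topology
open scoped Gradient RealInnerProductSpace

noncomputable section

namespace PowerEP

/-- The augmented sufficient statistic `(1, T(θ))`.  Its inner product with a natural parameter
`(c, η)` is `c + ⟪η, T(θ)⟫`. -/
def augStat {Θ E : Type*} (T : Θ → E) (θ : Θ) : WithLp 2 (ℝ × E) :=
  WithLp.toLp 2 (1, T θ)

section Family

variable {Θ : Type*} [MeasurableSpace Θ]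
variable {V : Type*} [NormedAddCommGroup V] [InnerProductSpace ℝ V]

/-- The member `θ ↦ exp ⟪η, S θ⟫` of the (unnormalised) exponential family with statistic `S`. -/
def expFam (S : Θ → V) (η : V) (θ : Θ) : ℝ :=
  Real.exp ⟪η, S θ⟫

/-- The natural parameter space: those `η` for which `exp ⟪η, S⟫` has finite mass. -/
def natDomain (ν : Measure Θ) (S : Θ → V) : Set V :=
  {η | Integrable (expFam S η) ν}

/-- The natural parameters whose member has finite mass and finite moments of `S`. -/
def meanDomain (ν : Measure Θ) (S : Θ → V) : Set V :=
  {η | Integrable (expFam S η) ν ∧ Integrable (fun θ => expFam S η θ • S θ) ν}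

/-- The components of `S` are linearly independent as functions modulo `ν`-null sets. -/
def LinIndepStat (ν : Measure Θ) (S : Θ → V) : Prop :=
  ∀ v : V, (∀ᵐ θ ∂ν, ⟪v, S θ⟫ = 0) → v = 0

/-! ### Unnormalised members -/

/-- Mean parameter `μ_q = ∫ q S` of the unnormalised member `q = exp ⟪η, S⟫`. -/
def meanParam (ν : Measure Θ) (S : Θ → V) (η : V) : V :=
  ∫ θ, expFam S η θ • S θ ∂ν

/-- `∫ q log L` for the unnormalised member `q = exp ⟪η, S⟫`. -/
def expLogLik (ν : Measure Θ) (S : Θ → V) (L : Θ → ℝ) (η : V) : ℝ :=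
  ∫ θ, expFam S η θ * Real.log (L θ) ∂ν

/-- `∫ q log L` as a function of the mean parameter `μ` of `q`.  When the components of `S` are
linearly independent, at most one member has mean parameter `μ`. -/
def expLogLikOfMean (ν : Measure Θ) (S : Θ → V) (L : Θ → ℝ) (μ : V) : ℝ :=
  expLogLik ν S L (Function.invFunOn (meanParam ν S) (meanDomain ν S) μ)

/-! ### Normalised members -/

/-- Log-partition function `A(η) = log ∫ exp ⟪η, S⟫`. -/
def logPartition (ν : Measure Θ) (S : Θ → V) (η : V) : ℝ :=
  Real.log (∫ θ, expFam S η θ ∂ν)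

/-- The normalised member `exp (⟪η, S θ⟫ - A(η))`. -/
def normFam (ν : Measure Θ) (S : Θ → V) (η : V) (θ : Θ) : ℝ :=
  Real.exp (⟪η, S θ⟫ - logPartition ν S η)

/-- Mean parameter `E_q[S]` of the normalised member `q`. -/
def normMeanParam (ν : Measure Θ) (S : Θ → V) (η : V) : V :=
  ∫ θ, normFam ν S η θ • S θ ∂ν

/-- `E_q[log L]` for the normalised member `q` with natural parameter `η`. -/
def normExpLogLik (ν : Measure Θ) (S : Θ → V) (L : Θ → ℝ) (η : V) : ℝ :=
  ∫ θ, normFam ν S η θ * Real.log (L θ) ∂ν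

/-- `E_q[log L]` as a function of the mean parameter `E_q[S]` of the normalised member `q`. -/
def normExpLogLikOfMean (ν : Measure Θ) (S : Θ → V) (L : Θ → ℝ) (m : V) : ℝ :=
  normExpLogLik ν S L (Function.invFunOn (normMeanParam ν S) (meanDomain ν S) m)

/-! ### One step of power EP -/

/-- The tilted distribution `q (L / t) ^ α`. -/
def tilted (q t L : Θ → ℝ) (α : ℝ) (θ : Θ) : ℝ :=
  q θ * (L θ / t θ) ^ α

/-- `exp ⟪η, S⟫` is the moment-matching projection of the unnormalised density `p` onto the
unnormalised exponential family: both have finite moments of `S`, and these agree. -/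
def IsMomentProj (ν : Measure Θ) (S : Θ → V) (p : Θ → ℝ) (η : V) : Prop :=
  Integrable (fun θ => p θ • S θ) ν ∧ Integrable (fun θ => expFam S η θ • S θ) ν ∧
    ∫ θ, expFam S η θ • S θ ∂ν = ∫ θ, p θ • S θ ∂ν

/-- One step of power EP with power `α` and damping `ρ` for the likelihood factor `L`, started from
the approximate posterior `q = exp ⟪ηq, S⟫` and the approximate likelihood `t = exp ⟪ηk, S⟫`,
returns `q' = exp ⟪ηq', S⟫` and `t' = exp ⟪ηk', S⟫`: with `qα` the moment-matching projection of
`q (L / t) ^ α`, one has `q' = q ^ (1 - ρ / α) * qα ^ (ρ / α)` and `t' = (q' / q) * t`. -/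
def IsPEPStep (ν : Measure Θ) (S : Θ → V) (L : Θ → ℝ) (ρ α : ℝ) (ηq ηk ηq' ηk' : V) : Prop :=
  ∃ ηα : V,
    IsMomentProj ν S (tilted (expFam S ηq) (expFam S ηk) L α) ηα ∧
    (∀ θ, expFam S ηq' θ = expFam S ηq θ ^ (1 - ρ / α) * expFam S ηα θ ^ (ρ / α)) ∧
    (∀ θ, expFam S ηk' θ = expFam S ηq' θ / expFam S ηq θ * expFam S ηk θ)

end Family

end PowerEP

end

/-! The damping exponent `ρ / α` turns the step into a difference quotient. Let `G α = ∫ q (L / t) ^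
α S`, and let `ψ` be the inverse of the mean-parameter map. The projection has natural parameter `ψ
(G α)`. At `α = 0` the tilted density is `q` itself, so `ψ (G 0) = ηq`, and the geometric averaging
moves both natural parameters by `ρ • (ψ (G α) - ψ (G 0)) / α`. The limit is therefore `ρ` times the
derivative of `ψ ∘ G` at `0⁺`.

With `M = ∫ q S Sᵀ`, the two factors are `Dψ = M⁻¹` and `G' 0 = ∫ q (log L - ⟪ηk, S⟫) S = ∫ q log L
S - M ηk`. Their product is `M⁻¹ (∫ q log L S) - ηk`. By the chain rule and the symmetry of `M`, the
first term is the gradient of `∫ q log L` in the mean parameter, which gives the damped update.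

Interiority supplies exponential moments in `‖S‖` (`exists_hasExpMoment`), and these allow
differentiation under the integral. Minimality makes `M` invertible and the mean-parameter map
injective, so the inverse function theorem yields `Dψ` (`hasFDerivAt_invFunOn_meanParam`). Dominated
convergence yields `G' 0` (`hasDerivWithinAt_integral_tilted`).

The normalised statement is the restriction to mean parameters `(1, m)`. Rescaling `q` scales `M`
and `∫ q log L S` alike, so the gradient does not see the mass of `q`. -/

noncomputable section

namespace PowerEP

/-! ### Exponential moments and differentiation in the natural parameter -/

section Calculus

variable {Θ : Type*} [MeasurableSpace Θ] {ν : Measure Θ}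
variable {V : Type*} [NormedAddCommGroup V] [InnerProductSpace ℝ V]
variable {W : Type*} [NormedAddCommGroup W] [NormedSpace ℝ W]
variable {S : Θ → V}

omit [MeasurableSpace Θ] in
lemma expFam_pos (S : Θ → V) (η : V) (θ : Θ) : 0 < expFam S η θ := Real.exp_pos _

omit [MeasurableSpace Θ] in
lemma expFam_add (S : Θ → V) (η ξ : V) (θ : Θ) :
    expFam S (η + ξ) θ = expFam S η θ * expFam S ξ θ := by
  simp [expFam, inner_add_left, Real.exp_add]

omit [MeasurableSpace Θ] in
lemma expFam_sub (S : Θ → V) (η ξ : V) (θ : Θ) :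
    expFam S (η - ξ) θ = expFam S η θ / expFam S ξ θ := by
  simp [expFam, inner_sub_left, Real.exp_sub]

omit [MeasurableSpace Θ] in
lemma expFam_smul (S : Θ → V) (a : ℝ) (η : V) (θ : Θ) :
    expFam S (a • η) θ = expFam S η θ ^ a := by
  rw [expFam, expFam, ← Real.exp_mul, real_inner_smul_left, mul_comm]

omit [MeasurableSpace Θ] in
lemma log_expFam (S : Θ → V) (η : V) (θ : Θ) : Real.log (expFam S η θ) = ⟪η, S θ⟫ :=
  Real.log_exp _

omit [MeasurableSpace Θ] in
lemma expFam_le (S : Θ → V) (η ξ : V) (θ : Θ) :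
    expFam S ξ θ ≤ expFam S η θ * Real.exp (‖ξ - η‖ * ‖S θ‖) := by
  rw [← add_sub_cancel η ξ, expFam_add, add_sub_cancel]
  exact mul_le_mul_of_nonneg_left (Real.exp_le_exp.2 (real_inner_le_norm _ _)) (expFam_pos ..).le

lemma aestronglyMeasurable_expFam (hS : AEStronglyMeasurable S ν) (η : V) :
    AEStronglyMeasurable (expFam S η) ν :=
  Real.continuous_exp.comp_aestronglyMeasurable (hS.const_inner)

/-- The weight `f` has an exponential moment of order `δ` in the norm of the statistic, under
the member with natural parameter `η`. -/
structure HasExpMoment (ν : Measure Θ) (S : Θ → V) (f : Θ → W) (η : V) (δ : ℝ) : Prop where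
  pos : 0 < δ
  aesm : AEStronglyMeasurable f ν
  integrable : Integrable (fun θ => expFam S η θ * Real.exp (δ * ‖S θ‖) * ‖f θ‖) ν

/-- Some coordinate of `x` is at least `‖x‖ / n` in absolute value, so one of finitely many linear
exponentials dominates. Integrability at finitely many natural parameters thus controls an
exponential of the norm; the summand `1` covers `n = 0`. -/
lemma exp_norm_le_sum {n : ℕ} (b : OrthonormalBasis (Fin n) ℝ V) {δ : ℝ} (hδ : 0 ≤ δ) (x : V) :
    Real.exp (δ * ‖x‖) ≤ 1 + ∑ i,
      (Real.exp ⟪((n : ℝ) * δ) • b i, x⟫ + Real.exp ⟪-(((n : ℝ) * δ) • b i), x⟫) := by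
  have hterm : ∀ i, 0 ≤ Real.exp ⟪((n : ℝ) * δ) • b i, x⟫ + Real.exp ⟪-(((n : ℝ) * δ) • b i), x⟫ :=
    fun i => by positivity
  have hnorm : ‖x‖ ≤ ∑ i, |⟪b i, x⟫| := by
    conv_lhs => rw [← b.sum_repr x]
    refine (norm_sum_le _ _).trans (Finset.sum_le_sum fun i _ => ?_)
    rw [norm_smul, b.repr_apply_apply, b.norm_eq_one, mul_one, Real.norm_eq_abs]
  rcases Nat.eq_zero_or_pos n with rfl | hpos
  · have h0 : ‖x‖ = 0 := le_antisymm (by simpa using hnorm) (norm_nonneg _)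
    simp [h0]
  · have hnpos : (0 : ℝ) < n := by exact_mod_cast hpos
    have hsum : ∑ _i : Fin n, ‖x‖ / n ≤ ∑ i, |⟪b i, x⟫| := by
      rwa [Finset.sum_const, Finset.card_univ, Fintype.card_fin, nsmul_eq_mul,
        mul_div_cancel₀ _ hnpos.ne']
    have hne : (Finset.univ : Finset (Fin n)).Nonempty := ⟨⟨0, hpos⟩, Finset.mem_univ _⟩
    obtain ⟨i, -, hi⟩ := Finset.exists_le_of_sum_le hne hsum
    have hi' : δ * ‖x‖ ≤ |n * δ * ⟪b i, x⟫| := by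
      rw [abs_mul, abs_of_nonneg (by positivity : 0 ≤ n * δ)]
      rw [div_le_iff₀ hnpos] at hi
      nlinarith
    have hle := Finset.single_le_sum (fun i _ => hterm i) (Finset.mem_univ i)
    have h1 : Real.exp (δ * ‖x‖) ≤
        Real.exp ⟪((n : ℝ) * δ) • b i, x⟫ + Real.exp ⟪-(((n : ℝ) * δ) • b i), x⟫ := by
      rw [inner_neg_left, real_inner_smul_left]
      rcases le_abs.1 hi' with h | h
      · exact (Real.exp_le_exp.2 h).trans (le_add_of_nonneg_right (Real.exp_pos _).le)
      · exact (Real.exp_le_exp.2 h).trans (le_add_of_nonneg_left (Real.exp_pos _).le)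
    linarith

lemma exists_hasExpMoment [FiniteDimensional ℝ V] (hS : AEStronglyMeasurable S ν) {f : Θ → W}
    (hf : AEStronglyMeasurable f ν) {η : V}
    (h : ∀ᶠ ξ in 𝓝 η, Integrable (fun θ => expFam S ξ θ • f θ) ν) :
    ∃ δ, HasExpMoment ν S f η δ := by
  obtain ⟨r, hr, hball⟩ := Metric.eventually_nhds_iff.1 h
  set n := Module.finrank ℝ V
  -- Chosen so that the shifts of length `n * δ` stay in the ball of radius `r`; `n + 1` avoids
  -- dividing by zero in dimension `0`.
  set δ : ℝ := r / (n + 1) / 2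
  have hδ : 0 < δ := by positivity
  have hnδ : n * δ < r := by
    have : (n + 1) * δ = r / 2 := by simp only [δ]; field_simp
    nlinarith
  have hI : ∀ v : V, ‖v‖ < r →
      Integrable (fun θ => expFam S η θ * Real.exp ⟪v, S θ⟫ * ‖f θ‖) ν := by
    intro v hv
    have := (hball (y := η + v) (by simpa [dist_eq_norm] using hv)).norm
    refine this.congr (ae_of_all _ fun θ => ?_)
    simp only [norm_smul, expFam_add, norm_mul, Real.norm_of_nonneg (expFam_pos S _ θ).le]
    rfl
  have hb : ∀ i, ‖(n * δ) • stdOrthonormalBasis ℝ V i‖ < r := fun i => by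
    rw [norm_smul, (stdOrthonormalBasis ℝ V).norm_eq_one, mul_one,
      Real.norm_of_nonneg (by positivity)]
    exact hnδ
  refine ⟨δ, hδ, hf, ?_⟩
  have hsum := (hI 0 (by simpa using hr)).add (integrable_finsetSum Finset.univ fun i _ =>
    (hI _ (hb i)).add (hI (-_) (by rw [norm_neg]; exact hb i)))
  refine hsum.mono' ?_ (ae_of_all _ fun θ => ?_)
  · exact ((aestronglyMeasurable_expFam hS η).mul
      (Real.continuous_exp.comp_aestronglyMeasurable (hS.norm.const_mul δ))).mul hf.norm
  · rw [Real.norm_of_nonneg (mul_nonneg (mul_nonneg (expFam_pos ..).le (Real.exp_pos _).le)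
      (norm_nonneg _))]
    have := mul_le_mul_of_nonneg_right (mul_le_mul_of_nonneg_left
      (exp_norm_le_sum (stdOrthonormalBasis ℝ V) hδ.le (S θ)) (expFam_pos S η θ).le) (norm_nonneg (f θ))
    refine this.trans (le_of_eq ?_)
    simp only [Pi.add_apply, inner_zero_left, Real.exp_zero, mul_add, add_mul, Finset.mul_sum,
      Finset.sum_mul, n]

namespace HasExpMoment

variable {f : Θ → W} {η ξ : V} {δ : ℝ}

lemma integrable_of_norm_le (hS : AEStronglyMeasurable S ν) (h : HasExpMoment ν S f η δ)
    (hξ : ‖ξ - η‖ ≤ δ) : Integrable (fun θ => expFam S ξ θ • f θ) ν := by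
  refine h.integrable.mono' ((aestronglyMeasurable_expFam hS ξ).smul h.aesm)
    (ae_of_all _ fun θ => ?_)
  rw [norm_smul, Real.norm_of_nonneg (expFam_pos ..).le]
  refine mul_le_mul_of_nonneg_right ((expFam_le S η ξ θ).trans ?_) (norm_nonneg _)
  exact mul_le_mul_of_nonneg_left (Real.exp_le_exp.2
    (mul_le_mul_of_nonneg_right hξ (norm_nonneg _))) (expFam_pos ..).le

lemma integrable_self (hS : AEStronglyMeasurable S ν) (h : HasExpMoment ν S f η δ) :
    Integrable (fun θ => expFam S η θ • f θ) ν :=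
  h.integrable_of_norm_le hS (by simpa using h.pos.le)

omit [NormedSpace ℝ W] in
lemma shift (hS : AEStronglyMeasurable S ν) (h : HasExpMoment ν S f η δ) (hξ : ‖ξ - η‖ < δ) :
    HasExpMoment ν S f ξ (δ - ‖ξ - η‖) := by
  refine ⟨sub_pos.2 hξ, h.aesm, h.integrable.mono' (((aestronglyMeasurable_expFam hS ξ).mul
      (Real.continuous_exp.comp_aestronglyMeasurable (hS.norm.const_mul _))).mul h.aesm.norm)
    (ae_of_all _ fun θ => ?_)⟩
  rw [Real.norm_of_nonneg (mul_nonneg (mul_nonneg (expFam_pos ..).le (Real.exp_pos _).le)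
      (norm_nonneg _))]
  refine mul_le_mul_of_nonneg_right ?_ (norm_nonneg _)
  calc expFam S ξ θ * Real.exp ((δ - ‖ξ - η‖) * ‖S θ‖)
      ≤ expFam S η θ * Real.exp (‖ξ - η‖ * ‖S θ‖) * Real.exp ((δ - ‖ξ - η‖) * ‖S θ‖) :=
        mul_le_mul_of_nonneg_right (expFam_le S η ξ θ) (Real.exp_pos _).le
    _ = expFam S η θ * Real.exp (δ * ‖S θ‖) := by
        rw [mul_assoc, ← Real.exp_add]; ring_nf

omit [NormedSpace ℝ W] in
lemma of_norm_le {W' : Type*} [NormedAddCommGroup W'] (hS : AEStronglyMeasurable S ν)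
    (h : HasExpMoment ν S f η δ) {g : Θ → W'} (hg : AEStronglyMeasurable g ν)
    (hgf : ∀ θ, ‖g θ‖ ≤ ‖S θ‖ * ‖f θ‖) : HasExpMoment ν S g η (δ / 2) := by
  have hδ := h.pos
  refine ⟨half_pos hδ, hg, (h.integrable.const_mul (2 / δ)).mono'
    (((aestronglyMeasurable_expFam hS η).mul
      (Real.continuous_exp.comp_aestronglyMeasurable (hS.norm.const_mul _))).mul hg.norm)
    (ae_of_all _ fun θ => ?_)⟩
  rw [Real.norm_of_nonneg (mul_nonneg (mul_nonneg (expFam_pos ..).le (Real.exp_pos _).le)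
      (norm_nonneg _))]
  -- A factor `‖S θ‖` is paid for with half of the exponential moment.
  have h1 : ‖S θ‖ ≤ 2 / δ * Real.exp (δ / 2 * ‖S θ‖) := by
    have := Real.add_one_le_exp (δ / 2 * ‖S θ‖)
    have h2 : ‖S θ‖ = 2 / δ * (δ / 2 * ‖S θ‖) := by field_simp
    rw [h2]
    refine mul_le_mul_of_nonneg_left ?_ (by positivity)
    rw [← h2]; linarith
  have h3 : ‖g θ‖ ≤ 2 / δ * Real.exp (δ / 2 * ‖S θ‖) * ‖f θ‖ :=
    (hgf θ).trans (mul_le_mul_of_nonneg_right h1 (norm_nonneg _))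
  calc _ ≤ expFam S η θ * Real.exp (δ / 2 * ‖S θ‖) * (2 / δ * Real.exp (δ / 2 * ‖S θ‖) * ‖f θ‖) :=
        mul_le_mul_of_nonneg_left h3 (mul_nonneg (expFam_pos ..).le (Real.exp_pos _).le)
    _ = 2 / δ * (expFam S η θ * (Real.exp (δ / 2 * ‖S θ‖) * Real.exp (δ / 2 * ‖S θ‖)) * ‖f θ‖) := by
        ring
    _ = _ := by rw [← Real.exp_add]; ring_nf

lemma aestronglyMeasurable_smulRight (hS : AEStronglyMeasurable S ν)
    (hf : AEStronglyMeasurable f ν) :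
    AEStronglyMeasurable (fun θ => (innerSL ℝ (S θ)).smulRight (f θ)) ν := by
  have hc : Continuous fun p : V × W => (innerSL ℝ p.1).smulRight p.2 := by fun_prop
  exact hc.comp_aestronglyMeasurable (hS.prodMk hf)

lemma smulRight (hS : AEStronglyMeasurable S ν) (h : HasExpMoment ν S f η δ) :
    HasExpMoment ν S (fun θ => (innerSL ℝ (S θ)).smulRight (f θ)) η (δ / 2) :=
  h.of_norm_le hS (aestronglyMeasurable_smulRight hS h.aesm) fun θ => by
    rw [ContinuousLinearMap.norm_smulRight_apply, innerSL_apply_norm]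

/-- Differentiation under the integral sign with respect to the natural parameter. -/
lemma hasFDerivAt (hS : AEStronglyMeasurable S ν) (h : HasExpMoment ν S f η δ) :
    HasFDerivAt (fun ξ => ∫ θ, expFam S ξ θ • f θ ∂ν)
      (∫ θ, expFam S η θ • (innerSL ℝ (S θ)).smulRight (f θ) ∂ν) η := by
  have h' := h.smulRight hS
  refine hasFDerivAt_integral_of_dominated_of_fderiv_le (𝕜 := ℝ)
    (F' := fun ξ θ => expFam S ξ θ • (innerSL ℝ (S θ)).smulRight (f θ))
    (bound := fun θ => expFam S η θ * Real.exp (δ / 2 * ‖S θ‖) *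
      ‖(innerSL ℝ (S θ)).smulRight (f θ)‖)
    (Metric.ball_mem_nhds η h'.pos) ?_ (h.integrable_self hS) ?_ ?_ h'.integrable ?_
  · exact .of_forall fun ξ => (aestronglyMeasurable_expFam hS ξ).smul h.aesm
  · exact (aestronglyMeasurable_expFam hS η).smul h'.aesm
  · refine ae_of_all _ fun θ ξ hξ => ?_
    rw [norm_smul, Real.norm_of_nonneg (expFam_pos ..).le]
    refine mul_le_mul_of_nonneg_right ((expFam_le S η ξ θ).trans ?_) (norm_nonneg _)
    rw [Metric.mem_ball, dist_eq_norm] at hξ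
    exact mul_le_mul_of_nonneg_left (Real.exp_le_exp.2
      (mul_le_mul_of_nonneg_right hξ.le (norm_nonneg _))) (expFam_pos ..).le
  · refine ae_of_all _ fun θ ξ _ => ?_
    have h1 : HasFDerivAt (fun x : V => ⟪x, S θ⟫) (innerSL ℝ (S θ)) ξ := by
      have := (innerSL ℝ (S θ)).hasFDerivAt (x := ξ)
      refine this.congr_of_eventuallyEq (.of_forall fun x => ?_)
      simp [real_inner_comm]
    have h2 := (h1.exp).smul_const (f θ)
    refine h2.congr_fderiv ?_
    ext v
    simp [expFam, smul_smul]

/-- The moment condition persists on a ball, so the derivative exists there; it is again an integral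
of the same kind, hence continuous at `η`. Strictness is what the inverse function theorem requires.
-/
lemma hasStrictFDerivAt (hS : AEStronglyMeasurable S ν) (h : HasExpMoment ν S f η δ) :
    HasStrictFDerivAt (fun ξ => ∫ θ, expFam S ξ θ • f θ ∂ν)
      (∫ θ, expFam S η θ • (innerSL ℝ (S θ)).smulRight (f θ) ∂ν) η := by
  refine hasStrictFDerivAt_of_hasFDerivAt_of_continuousAt (𝕜 := ℝ)
    (f' := fun ξ => ∫ θ, expFam S ξ θ • (innerSL ℝ (S θ)).smulRight (f θ) ∂ν) ?_
    ((h.smulRight hS).hasFDerivAt hS).continuousAt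
  filter_upwards [Metric.ball_mem_nhds η h.pos] with ξ hξ
  rw [Metric.mem_ball, dist_eq_norm] at hξ
  exact (h.shift hS hξ).hasFDerivAt hS

end HasExpMoment

end Calculus

/-! ### The mean-parameter map and its inverse -/

section MeanParam

variable {Θ : Type*} [MeasurableSpace Θ] {ν : Measure Θ}
variable {V : Type*} [NormedAddCommGroup V] [InnerProductSpace ℝ V]
variable {S : Θ → V} {η η₁ η₂ : V} {δ : ℝ}

/-- The second-moment operator `x ↦ ∫ exp ⟪η, S⟫ ⟪S, x⟫ S`. -/
def momentOp (ν : Measure Θ) (S : Θ → V) (η : V) : V →L[ℝ] V :=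
  ∫ θ, expFam S η θ • (innerSL ℝ (S θ)).smulRight (S θ) ∂ν

lemma HasExpMoment.stat (hS : AEStronglyMeasurable S ν)
    (h : HasExpMoment ν S (fun _ => (1 : ℝ)) η δ) : HasExpMoment ν S S η (δ / 2) :=
  h.of_norm_le hS hS fun θ => by simp

lemma HasExpMoment.integrable_smul_stat (hS : AEStronglyMeasurable S ν) {f : Θ → ℝ}
    (h : HasExpMoment ν S f η δ) : Integrable (fun θ => expFam S η θ • f θ • S θ) ν :=
  (h.of_norm_le hS (g := fun θ => f θ • S θ) (h.aesm.smul hS) fun θ => by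
    rw [norm_smul, mul_comm]).integrable_self hS

/-- The mean parameter determines the natural parameter. -/
lemma eq_of_meanParam_eq [CompleteSpace V] (hmin : LinIndepStat ν S)
    (h₁ : Integrable (fun θ => expFam S η₁ θ • S θ) ν)
    (h₂ : Integrable (fun θ => expFam S η₂ θ • S θ) ν)
    (h : meanParam ν S η₁ = meanParam ν S η₂) : η₁ = η₂ := by
  have hint : Integrable (fun θ => ⟪η₁ - η₂, expFam S η₁ θ • S θ - expFam S η₂ θ • S θ⟫) ν :=
    (h₁.sub h₂).const_inner _
  -- Strict monotonicity of `exp`: this integrand is nonnegative and vanishes only where `⟪η₁, S⟫ =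
  -- ⟪η₂, S⟫`, while equal mean parameters force its integral to be zero.
  have heq : ∀ θ, ⟪η₁ - η₂, expFam S η₁ θ • S θ - expFam S η₂ θ • S θ⟫ =
      (Real.exp ⟪η₁, S θ⟫ - Real.exp ⟪η₂, S θ⟫) * (⟪η₁, S θ⟫ - ⟪η₂, S θ⟫) := fun θ => by
    rw [← sub_smul, real_inner_smul_right, inner_sub_left]; rfl
  have hzero : ∫ θ, ⟪η₁ - η₂, expFam S η₁ θ • S θ - expFam S η₂ θ • S θ⟫ ∂ν = 0 := by
    refine (integral_inner (h₁.sub h₂) _).trans ?_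
    simp only [Pi.sub_apply]
    rw [integral_sub h₁ h₂]
    have : ∫ θ, expFam S η₁ θ • S θ ∂ν = ∫ θ, expFam S η₂ θ • S θ ∂ν := h
    rw [this, sub_self, inner_zero_right]
  have hnn : 0 ≤ fun θ => ⟪η₁ - η₂, expFam S η₁ θ • S θ - expFam S η₂ θ • S θ⟫ := fun θ => by
    simp only [Pi.zero_apply, heq]
    rcases le_total ⟪η₁, S θ⟫ ⟪η₂, S θ⟫ with hle | hle
    · exact mul_nonneg_of_nonpos_of_nonpos (sub_nonpos.2 (Real.exp_le_exp.2 hle))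
        (sub_nonpos.2 hle)
    · exact mul_nonneg (sub_nonneg.2 (Real.exp_le_exp.2 hle)) (sub_nonneg.2 hle)
  have hae := (integral_eq_zero_iff_of_nonneg hnn hint).1 hzero
  refine sub_eq_zero.1 (hmin _ ?_)
  filter_upwards [hae] with θ hθ
  rw [inner_sub_left]
  simp only [Pi.zero_apply, heq, mul_eq_zero, sub_eq_zero, Real.exp_eq_exp, or_self] at hθ
  rw [hθ, sub_self]

/-- Two members that agree almost everywhere have the same natural parameter. -/
lemma eq_of_expFam_ae_eq (hmin : LinIndepStat ν S) (h : ∀ᵐ θ ∂ν, expFam S η₁ θ = expFam S η₂ θ) :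
    η₁ = η₂ := by
  refine sub_eq_zero.1 (hmin _ ?_)
  filter_upwards [h] with θ hθ
  rw [inner_sub_left, ← log_expFam, ← log_expFam, hθ, sub_self]

lemma integrable_momentOp (hS : AEStronglyMeasurable S ν)
    (h : HasExpMoment ν S (fun _ => (1 : ℝ)) η δ) :
    Integrable (fun θ => expFam S η θ • (innerSL ℝ (S θ)).smulRight (S θ)) ν :=
  ((h.stat hS).smulRight hS).integrable_self hS

lemma momentOp_apply (hS : AEStronglyMeasurable S ν)
    (h : HasExpMoment ν S (fun _ => (1 : ℝ)) η δ) (x : V) :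
    momentOp ν S η x = ∫ θ, expFam S η θ • ⟪S θ, x⟫ • S θ ∂ν := by
  rw [momentOp, ContinuousLinearMap.integral_apply (integrable_momentOp hS h)]
  simp

lemma integrable_momentOp_apply (hS : AEStronglyMeasurable S ν)
    (h : HasExpMoment ν S (fun _ => (1 : ℝ)) η δ) (x : V) :
    Integrable (fun θ => expFam S η θ • ⟪S θ, x⟫ • S θ) ν :=
  (integrable_momentOp hS h).apply_continuousLinearMap x

lemma inner_momentOp [CompleteSpace V] (hS : AEStronglyMeasurable S ν)
    (h : HasExpMoment ν S (fun _ => (1 : ℝ)) η δ) (x y : V) :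
    ⟪momentOp ν S η x, y⟫ = ∫ θ, expFam S η θ * (⟪S θ, x⟫ * ⟪S θ, y⟫) ∂ν := by
  rw [real_inner_comm, momentOp_apply hS h, ← integral_inner (integrable_momentOp_apply hS h x)]
  refine integral_congr_ae (ae_of_all _ fun θ => ?_)
  simp only [real_inner_smul_right, real_inner_comm y]

lemma momentOp_symm [CompleteSpace V] (hS : AEStronglyMeasurable S ν)
    (h : HasExpMoment ν S (fun _ => (1 : ℝ)) η δ) (x y : V) :
    ⟪momentOp ν S η x, y⟫ = ⟪x, momentOp ν S η y⟫ := by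
  rw [real_inner_comm _ x, inner_momentOp hS h, inner_momentOp hS h]
  simp only [mul_comm]

/-- The quadratic form is `∫ q ⟪S, x⟫²`, so a kernel vector is orthogonal to `S` almost everywhere,
which minimality excludes. -/
lemma momentOp_injective [CompleteSpace V] (hmin : LinIndepStat ν S)
    (hS : AEStronglyMeasurable S ν) (h : HasExpMoment ν S (fun _ => (1 : ℝ)) η δ) :
    Function.Injective (momentOp ν S η) := by
  refine (injective_iff_map_eq_zero _).2 fun x hx => hmin x ?_
  have hint : Integrable (fun θ => expFam S η θ * (⟪S θ, x⟫ * ⟪S θ, x⟫)) ν := by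
    refine ((integrable_momentOp_apply hS h x).const_inner x).congr (ae_of_all _ fun θ => ?_)
    simp only [real_inner_smul_right, real_inner_comm x]
  have hzero := inner_momentOp hS h x x
  rw [hx, inner_zero_left] at hzero
  have hae := (integral_eq_zero_iff_of_nonneg
    (fun θ => mul_nonneg (expFam_pos S η θ).le (mul_self_nonneg _)) hint).1 hzero.symm
  filter_upwards [hae] with θ hθ
  rw [real_inner_comm]
  simpa [(expFam_pos S η θ).ne'] using hθ

/-- The second-moment operator as a linear automorphism. -/
lemma exists_momentEquiv [FiniteDimensional ℝ V] (hmin : LinIndepStat ν S)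
    (hS : AEStronglyMeasurable S ν) (h : HasExpMoment ν S (fun _ => (1 : ℝ)) η δ) :
    ∃ M : V ≃L[ℝ] V, (M : V →L[ℝ] V) = momentOp ν S η := by
  have := FiniteDimensional.complete ℝ V
  refine ⟨(LinearEquiv.ofInjectiveEndo (momentOp ν S η : V →ₗ[ℝ] V)
    (momentOp_injective hmin hS h)).toContinuousLinearEquiv, ?_⟩
  ext x
  rfl

lemma hasStrictFDerivAt_meanParam (hS : AEStronglyMeasurable S ν)
    (h : HasExpMoment ν S (fun _ => (1 : ℝ)) η δ) :
    HasStrictFDerivAt (meanParam ν S) (momentOp ν S η) η :=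
  (h.stat hS).hasStrictFDerivAt hS

lemma eventually_mem_meanDomain (hS : AEStronglyMeasurable S ν)
    (h : HasExpMoment ν S (fun _ => (1 : ℝ)) η δ) : ∀ᶠ ξ in 𝓝 η, ξ ∈ meanDomain ν S := by
  have h' := h.stat hS
  filter_upwards [Metric.ball_mem_nhds η h.pos, Metric.ball_mem_nhds η h'.pos] with ξ hξ hξ'
  rw [Metric.mem_ball, dist_eq_norm] at hξ hξ'
  exact ⟨by simpa using h.integrable_of_norm_le hS hξ.le, h'.integrable_of_norm_le hS hξ'.le⟩

/-- Injectivity makes the inverse obtained by choice a genuine left inverse. -/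
lemma invFunOn_meanParam [CompleteSpace V] (hmin : LinIndepStat ν S) (hη : η ∈ meanDomain ν S) :
    Function.invFunOn (meanParam ν S) (meanDomain ν S) (meanParam ν S η) = η := by
  have hex : ∃ ξ ∈ meanDomain ν S, meanParam ν S ξ = meanParam ν S η := ⟨η, hη, rfl⟩
  exact eq_of_meanParam_eq hmin (Function.invFunOn_mem hex).2 hη.2 (Function.invFunOn_eq hex)

/-- Near the mean parameter of a regular member, every vector is a mean parameter. -/
lemma eventually_exists_meanParam_eq [FiniteDimensional ℝ V] (hmin : LinIndepStat ν S)
    (hS : AEStronglyMeasurable S ν) (h : HasExpMoment ν S (fun _ => (1 : ℝ)) η δ) :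
    ∀ᶠ μ in 𝓝 (meanParam ν S η), ∃ ξ ∈ meanDomain ν S, meanParam ν S ξ = μ := by
  have := FiniteDimensional.complete ℝ V
  obtain ⟨M, hM⟩ := exists_momentEquiv hmin hS h
  have hd : HasStrictFDerivAt (meanParam ν S) (M : V →L[ℝ] V) η :=
    hM ▸ hasStrictFDerivAt_meanParam hS h
  rw [← hd.map_nhds_eq_of_equiv]
  exact (eventually_mem_meanDomain hS h).mono fun ξ hξ => ⟨ξ, hξ, rfl⟩

/-- The natural parameter is a differentiable function of the mean parameter. -/
lemma hasFDerivAt_invFunOn_meanParam [FiniteDimensional ℝ V] (hmin : LinIndepStat ν S)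
    (hS : AEStronglyMeasurable S ν) (h : HasExpMoment ν S (fun _ => (1 : ℝ)) η δ)
    {M : V ≃L[ℝ] V} (hM : (M : V →L[ℝ] V) = momentOp ν S η) :
    HasFDerivAt (Function.invFunOn (meanParam ν S) (meanDomain ν S)) (M.symm : V →L[ℝ] V)
      (meanParam ν S η) := by
  have := FiniteDimensional.complete ℝ V
  have hd : HasStrictFDerivAt (meanParam ν S) (M : V →L[ℝ] V) η :=
    hM ▸ hasStrictFDerivAt_meanParam hS h
  refine (hd.to_localInverse.hasFDerivAt).congr_of_eventuallyEq ?_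
  -- The mean-parameter map sends `𝓝 η` onto `𝓝` of its value, so the two inverses need only be
  -- compared at `meanParam ν S ξ`, where both return `ξ`.
  rw [← hd.map_nhds_eq_of_equiv]
  change ∀ᶠ ξ in 𝓝 η, _
  filter_upwards [eventually_mem_meanDomain hS h, hd.eventually_left_inverse] with ξ hξ hl
  rw [hl, invFunOn_meanParam hmin hξ]

/-- The derivative of `∫ q log L` with respect to the mean parameter of `q`. -/
lemma hasGradientAt_expLogLikOfMean [FiniteDimensional ℝ V] [CompleteSpace V]
    (hmin : LinIndepStat ν S)
    (hS : AEStronglyMeasurable S ν) (h : HasExpMoment ν S (fun _ => (1 : ℝ)) η δ)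
    {L : Θ → ℝ} {δ' : ℝ} (hL : HasExpMoment ν S (fun θ => Real.log (L θ)) η δ')
    {M : V ≃L[ℝ] V} (hM : (M : V →L[ℝ] V) = momentOp ν S η) :
    HasGradientAt (expLogLikOfMean ν S L)
      (M.symm (∫ θ, expFam S η θ • Real.log (L θ) • S θ ∂ν)) (meanParam ν S η) := by
  have hinv := invFunOn_meanParam hmin (eventually_mem_meanDomain hS h).self_of_nhds
  have h₁ : HasFDerivAt (expLogLik ν S L)
      (∫ θ, expFam S η θ • (innerSL ℝ (S θ)).smulRight (Real.log (L θ)) ∂ν) η :=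
    hL.hasFDerivAt hS
  rw [← hinv] at h₁
  have h₂ := h₁.comp _ (hasFDerivAt_invFunOn_meanParam hmin hS h hM)
  rw [hinv] at h₂
  refine (hasGradientAt_iff_hasFDerivAt).2 (h₂.congr_fderiv ?_)
  ext x
  have hint := (hL.smulRight hS).integrable_self hS
  have hint' := hL.integrable_smul_stat hS
  -- Testing on vectors `M y` lets the symmetry of `M` cancel `M.symm`.
  obtain ⟨y, rfl⟩ := M.surjective x
  have hsymm : ∀ b, ⟪M.symm b, M y⟫ = ⟪b, y⟫ := fun b => by
    have := momentOp_symm hS h (M.symm b) y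
    rw [← hM] at this
    simpa using this.symm
  simp only [ContinuousLinearMap.comp_apply, ContinuousLinearEquiv.coe_coe,
    ContinuousLinearEquiv.symm_apply_apply, InnerProductSpace.toDual_apply_apply, hsymm]
  rw [ContinuousLinearMap.integral_apply hint, real_inner_comm, ← integral_inner hint']
  refine integral_congr_ae (ae_of_all _ fun θ => ?_)
  simp only [_root_.smul_apply, ContinuousLinearMap.smulRight_apply,
    innerSL_apply_apply, smul_eq_mul, real_inner_smul_right, real_inner_comm y]
  ring

end MeanParam

/-! ### Right derivative at zero of the tilted moments -/

section Tilted

variable {Θ : Type*} [MeasurableSpace Θ] {ν : Measure Θ}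
variable {V : Type*} [NormedAddCommGroup V] [InnerProductSpace ℝ V]
variable {S : Θ → V} {L : Θ → ℝ} {ηq ηk : V} {δ δ' : ℝ}

/-- Convexity of `α ↦ x ^ α`: the difference quotient from `0` is at least the slope `log x` there,
and at most the quotient at `β`. -/
lemma abs_rpow_sub_one_div_le {x α β : ℝ} (hx : 0 < x) (hα : 0 < α) (hαβ : α ≤ β) :
    |α⁻¹ * (x ^ α - 1)| ≤ |Real.log x| + β⁻¹ * x ^ β := by
  have hβ : 0 < β := hα.trans_le hαβ
  set l := Real.log x
  rw [Real.rpow_def_of_pos hx, Real.rpow_def_of_pos hx, abs_le]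
  have hpos : 0 ≤ β⁻¹ * Real.exp (l * β) := by positivity
  constructor
  · have h1 := Real.add_one_le_exp (l * α)
    have h2 : l ≤ α⁻¹ * (Real.exp (l * α) - 1) := by
      rw [inv_mul_eq_div, le_div_iff₀ hα]; linarith
    linarith [neg_abs_le l]
  · have hconv := convexOn_exp.2 (Set.mem_univ (l * β)) (Set.mem_univ 0)
      (show 0 ≤ α / β by positivity)
      (show 0 ≤ 1 - α / β by rw [sub_nonneg, div_le_one hβ]; exact hαβ)
      (by ring)
    have e : (α / β) • (l * β) + (1 - α / β) • (0 : ℝ) = l * α := by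
      simp only [smul_eq_mul]; field_simp; ring
    rw [e] at hconv
    simp only [smul_eq_mul, Real.exp_zero, mul_one] at hconv
    have h2 : α⁻¹ * (Real.exp (l * α) - 1) ≤ β⁻¹ * Real.exp (l * β) := by
      have hle : Real.exp (l * α) - 1 ≤ α * (β⁻¹ * Real.exp (l * β)) := by
        have : 0 ≤ α / β := by positivity
        calc _ ≤ α / β * Real.exp (l * β) := by linarith
          _ = _ := by ring
      rw [inv_mul_eq_div, div_le_iff₀ hα]; linarith
    linarith [abs_nonneg l]

lemma tendsto_rpow_sub_one_div {x : ℝ} (hx : 0 < x) :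
    Tendsto (fun α : ℝ => α⁻¹ * (x ^ α - 1)) (𝓝[>] 0) (𝓝 (Real.log x)) := by
  have h := (Real.hasStrictDerivAt_const_rpow hx 0).hasDerivAt.hasDerivWithinAt (s := Set.Ioi 0)
  rw [hasDerivWithinAt_iff_tendsto_slope' (by simp)] at h
  simp only [Real.rpow_zero, one_mul] at h
  refine h.congr fun α => ?_
  simp [slope_def_field, inv_mul_eq_div]

/-- A dominating function for the difference quotients of the moments of the tilted density. -/
def tiltBound (S : Θ → V) (L : Θ → ℝ) (ηq ηk : V) (β : ℝ) (θ : Θ) : ℝ :=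
  expFam S ηq θ * (|Real.log (L θ)| * ‖S θ‖) + ‖ηk‖ * (expFam S ηq θ * ‖S θ‖ ^ 2) +
    (β / 2)⁻¹ * (tilted (expFam S ηq) (expFam S ηk) L β θ + expFam S ηq θ * ‖S θ‖ ^ 2)

lemma integrable_tiltBound (hS : AEStronglyMeasurable S ν)
    (h : HasExpMoment ν S (fun _ => (1 : ℝ)) ηq δ)
    (hL : HasExpMoment ν S (fun θ => Real.log (L θ)) ηq δ') {β : ℝ}
    (ht : Integrable (tilted (expFam S ηq) (expFam S ηk) L β) ν) :
    Integrable (tiltBound S L ηq ηk β) ν := by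
  have h₁ : Integrable (fun θ => expFam S ηq θ * (|Real.log (L θ)| * ‖S θ‖)) ν :=
    (hL.of_norm_le hS (g := fun θ => |Real.log (L θ)| * ‖S θ‖) (hL.aesm.norm.mul hS.norm)
      fun θ => by simp [mul_comm]).integrable_self hS
  have h₂ : Integrable (fun θ => expFam S ηq θ * ‖S θ‖ ^ 2) ν :=
    ((h.stat hS).of_norm_le hS (g := fun θ => ‖S θ‖ ^ 2) (hS.norm.pow 2)
      fun θ => by simp [sq]).integrable_self hS
  exact (h₁.add (h₂.const_mul _)).add ((ht.add h₂).const_mul _)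

-- The quotient is bounded at exponent `β / 2`, not `β`, because of the extra factor `‖S θ‖`: `x ^
-- (β / 2) * ‖S θ‖ ≤ x ^ β + ‖S θ‖ ^ 2`. Hence finite mass of the tilted density at `β` suffices,
-- without assuming any moments of it.
omit [MeasurableSpace Θ] in
lemma norm_tilted_quotient_le {α β : ℝ} (hα : 0 < α) (hαβ : α ≤ β / 2) {θ : Θ} (hθ : 0 < L θ) :
    ‖(α⁻¹ * (tilted (expFam S ηq) (expFam S ηk) L α θ - expFam S ηq θ)) • S θ‖ ≤
      tiltBound S L ηq ηk β θ := by
  have hq := expFam_pos S ηq θ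
  have ht := expFam_pos S ηk θ
  set x := L θ / expFam S ηk θ with hx
  have hxpos : 0 < x := div_pos hθ ht
  have e : α⁻¹ * (tilted (expFam S ηq) (expFam S ηk) L α θ - expFam S ηq θ) =
      expFam S ηq θ * (α⁻¹ * (x ^ α - 1)) := by rw [tilted]; ring
  rw [e, norm_smul, norm_mul, Real.norm_of_nonneg hq.le, Real.norm_eq_abs]
  have hlog : |Real.log x| ≤ |Real.log (L θ)| + ‖ηk‖ * ‖S θ‖ := by
    rw [hx, Real.log_div hθ.ne' ht.ne', log_expFam]
    exact (abs_sub _ _).trans (add_le_add_right (abs_real_inner_le_norm _ _) _)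
  have hsq : x ^ (β / 2) * ‖S θ‖ ≤ x ^ β + ‖S θ‖ ^ 2 := by
    have : x ^ β = x ^ (β / 2) * x ^ (β / 2) := by rw [← Real.rpow_add hxpos]; ring_nf
    rw [this]
    nlinarith [sq_nonneg (x ^ (β / 2) - ‖S θ‖), sq_nonneg (x ^ (β / 2)), sq_nonneg ‖S θ‖]
  have hβ : 0 ≤ (β / 2)⁻¹ := inv_nonneg.2 (hα.le.trans hαβ)
  have hb := abs_rpow_sub_one_div_le hxpos hα hαβ
  have h1 : |α⁻¹ * (x ^ α - 1)| * ‖S θ‖ ≤ |Real.log (L θ)| * ‖S θ‖ + ‖ηk‖ * ‖S θ‖ ^ 2 +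
      (β / 2)⁻¹ * (x ^ β + ‖S θ‖ ^ 2) :=
    calc _ ≤ (|Real.log (L θ)| + ‖ηk‖ * ‖S θ‖ + (β / 2)⁻¹ * x ^ (β / 2)) * ‖S θ‖ :=
          mul_le_mul_of_nonneg_right (hb.trans (by linarith)) (norm_nonneg _)
      _ = |Real.log (L θ)| * ‖S θ‖ + ‖ηk‖ * ‖S θ‖ ^ 2 + (β / 2)⁻¹ * (x ^ (β / 2) * ‖S θ‖) := by
          ring
      _ ≤ _ := by gcongr
  calc _ = expFam S ηq θ * (|α⁻¹ * (x ^ α - 1)| * ‖S θ‖) := by ring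
    _ ≤ _ := mul_le_mul_of_nonneg_left h1 hq.le
    _ = _ := by rw [tiltBound, tilted]; ring

lemma aestronglyMeasurable_tilted_quotient (hS : AEStronglyMeasurable S ν)
    (hL : AEMeasurable L ν) (α : ℝ) :
    AEStronglyMeasurable (fun θ =>
      (α⁻¹ * (tilted (expFam S ηq) (expFam S ηk) L α θ - expFam S ηq θ)) • S θ) ν := by
  have hq := (aestronglyMeasurable_expFam hS ηq).aemeasurable
  have ht := (aestronglyMeasurable_expFam hS ηk).aemeasurable
  have : AEMeasurable (fun θ =>
      α⁻¹ * (tilted (expFam S ηq) (expFam S ηk) L α θ - expFam S ηq θ)) ν :=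
    ((hq.mul ((hL.div ht).pow_const α)).sub hq).const_mul _
  exact this.aestronglyMeasurable.smul hS

lemma integrable_tilted_quotient (hS : AEStronglyMeasurable S ν)
    (h : HasExpMoment ν S (fun _ => (1 : ℝ)) ηq δ)
    (hL : HasExpMoment ν S (fun θ => Real.log (L θ)) ηq δ') (hLm : AEMeasurable L ν)
    (hLpos : ∀ᵐ θ ∂ν, 0 < L θ) {α β : ℝ} (hα : 0 < α) (hαβ : α ≤ β / 2)
    (ht : Integrable (tilted (expFam S ηq) (expFam S ηk) L β) ν) :
    Integrable (fun θ =>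
      (α⁻¹ * (tilted (expFam S ηq) (expFam S ηk) L α θ - expFam S ηq θ)) • S θ) ν :=
  (integrable_tiltBound hS h hL ht).mono' (aestronglyMeasurable_tilted_quotient hS hLm α)
    (hLpos.mono fun _ hθ => norm_tilted_quotient_le hα hαβ hθ)

lemma integrable_tilted_smul (hS : AEStronglyMeasurable S ν)
    (h : HasExpMoment ν S (fun _ => (1 : ℝ)) ηq δ)
    (hL : HasExpMoment ν S (fun θ => Real.log (L θ)) ηq δ') (hLm : AEMeasurable L ν)
    (hLpos : ∀ᵐ θ ∂ν, 0 < L θ) {α β : ℝ} (hα : 0 < α) (hαβ : α ≤ β / 2)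
    (ht : Integrable (tilted (expFam S ηq) (expFam S ηk) L β) ν) :
    Integrable (fun θ => tilted (expFam S ηq) (expFam S ηk) L α θ • S θ) ν := by
  refine (((h.stat hS).integrable_self hS).add
    ((integrable_tilted_quotient hS h hL hLm hLpos hα hαβ ht).smul α)).congr
    (ae_of_all _ fun θ => ?_)
  simp only [Pi.add_apply, Pi.smul_apply, smul_smul, ← add_smul]
  congr 1
  field_simp
  ring

/-- The right derivative at `α = 0` of the moments of the tilted density. -/
lemma hasDerivWithinAt_integral_tilted (hS : AEStronglyMeasurable S ν)
    (h : HasExpMoment ν S (fun _ => (1 : ℝ)) ηq δ)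
    (hL : HasExpMoment ν S (fun θ => Real.log (L θ)) ηq δ') (hLm : AEMeasurable L ν)
    (hLpos : ∀ᵐ θ ∂ν, 0 < L θ) {β : ℝ} (hβ : 0 < β)
    (ht : Integrable (tilted (expFam S ηq) (expFam S ηk) L β) ν) :
    HasDerivWithinAt (fun α => ∫ θ, tilted (expFam S ηq) (expFam S ηk) L α θ • S θ ∂ν)
      ((∫ θ, expFam S ηq θ • Real.log (L θ) • S θ ∂ν) - momentOp ν S ηq ηk) (Set.Ioi 0) 0 := by
  have hlim : (∫ θ, expFam S ηq θ • Real.log (L θ) • S θ ∂ν) - momentOp ν S ηq ηk =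
      ∫ θ, (expFam S ηq θ * Real.log (L θ / expFam S ηk θ)) • S θ ∂ν := by
    rw [momentOp_apply hS h, ← integral_sub (hL.integrable_smul_stat hS)
      (integrable_momentOp_apply hS h ηk)]
    refine integral_congr_ae (hLpos.mono fun θ hθ => ?_)
    simp only [Real.log_div hθ.ne' (expFam_pos S ηk θ).ne', log_expFam, smul_smul, ← sub_smul,
      real_inner_comm ηk]
    congr 1
    ring
  have hsmall : ∀ᶠ α in 𝓝[>] (0 : ℝ), 0 < α ∧ α ≤ β / 2 :=
    Ioc_mem_nhdsGT (half_pos hβ)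
  have h0 : (fun θ => tilted (expFam S ηq) (expFam S ηk) L 0 θ • S θ) =
      fun θ => expFam S ηq θ • S θ := by
    funext θ; simp [tilted]
  rw [hlim, hasDerivWithinAt_iff_tendsto_slope' (by simp)]
  have key : Tendsto (fun α : ℝ => ∫ θ,
      (α⁻¹ * (tilted (expFam S ηq) (expFam S ηk) L α θ - expFam S ηq θ)) • S θ ∂ν) (𝓝[>] 0)
      (𝓝 (∫ θ, (expFam S ηq θ * Real.log (L θ / expFam S ηk θ)) • S θ ∂ν)) := by
    refine tendsto_integral_filter_of_dominated_convergence (tiltBound S L ηq ηk β)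
      (.of_forall fun α => aestronglyMeasurable_tilted_quotient hS hLm α)
      (hsmall.mono fun α hα => hLpos.mono fun θ hθ => norm_tilted_quotient_le hα.1 hα.2 hθ)
      (integrable_tiltBound hS h hL ht) (hLpos.mono fun θ hθ => ?_)
    refine Tendsto.smul_const ?_ _
    refine ((tendsto_rpow_sub_one_div (div_pos hθ (expFam_pos S ηk θ))).const_mul _).congr
      fun α => ?_
    rw [tilted]; ring
  refine key.congr' (hsmall.mono fun α hα => ?_)
  rw [slope_def_module, h0, ← integral_sub
    (integrable_tilted_smul hS h hL hLm hLpos hα.1 hα.2 ht) ((h.stat hS).integrable_self hS),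
    sub_zero, ← integral_smul]
  simp only [← sub_smul, smul_smul]

end Tilted

/-! ### The power-EP step in natural parameters -/

section Step

variable {Θ : Type*} [MeasurableSpace Θ] {ν : Measure Θ}
variable {V : Type*} [NormedAddCommGroup V] [InnerProductSpace ℝ V]
variable {S : Θ → V} {L : Θ → ℝ} {η η' ηq ηk : V} {δ δ' : ℝ}

lemma isPEPStep_iff (hmin : LinIndepStat ν S) {ρ α : ℝ} {ηq' ηk' : V} :
    IsPEPStep ν S L ρ α ηq ηk ηq' ηk' ↔
      ∃ ηα, IsMomentProj ν S (tilted (expFam S ηq) (expFam S ηk) L α) ηα ∧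
        ηq' = (1 - ρ / α) • ηq + (ρ / α) • ηα ∧ ηk' = ηq' - ηq + ηk := by
  refine exists_congr fun ηα => and_congr_right fun _ => and_congr ?_ ?_
  · have e : ∀ θ, expFam S ηq θ ^ (1 - ρ / α) * expFam S ηα θ ^ (ρ / α) =
        expFam S ((1 - ρ / α) • ηq + (ρ / α) • ηα) θ := fun θ => by
      rw [expFam_add, expFam_smul, expFam_smul]
    simp only [e]
    exact ⟨fun h => eq_of_expFam_ae_eq hmin (ae_of_all _ h), fun h _ => by rw [h]⟩
  · have e : ∀ θ, expFam S ηq' θ / expFam S ηq θ * expFam S ηk θ =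
        expFam S (ηq' - ηq + ηk) θ := fun θ => by
      rw [expFam_add, expFam_sub]
    simp only [e]
    exact ⟨fun h => eq_of_expFam_ae_eq hmin (ae_of_all _ h), fun h _ => by rw [h]⟩

variable [FiniteDimensional ℝ V] [CompleteSpace V]

/-- For small `α` the moment-matching projection of the tilted density exists, is unique, and is
given by the inverse of the mean parameter map. -/
lemma eventually_isMomentProj_iff (hmin : LinIndepStat ν S) (hS : AEStronglyMeasurable S ν)
    (h : HasExpMoment ν S (fun _ => (1 : ℝ)) ηq δ)
    (hL : HasExpMoment ν S (fun θ => Real.log (L θ)) ηq δ') (hLm : AEMeasurable L ν)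
    (hLpos : ∀ᵐ θ ∂ν, 0 < L θ) {β : ℝ} (hβ : 0 < β)
    (ht : Integrable (tilted (expFam S ηq) (expFam S ηk) L β) ν) :
    ∀ᶠ α in 𝓝[>] (0 : ℝ), ∀ ξ,
      IsMomentProj ν S (tilted (expFam S ηq) (expFam S ηk) L α) ξ ↔
        ξ = Function.invFunOn (meanParam ν S) (meanDomain ν S)
          (∫ θ, tilted (expFam S ηq) (expFam S ηk) L α θ • S θ ∂ν) := by
  have hcont := (hasDerivWithinAt_integral_tilted hS h hL hLm hLpos hβ ht).continuousWithinAt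
  have h0 : ∫ θ, tilted (expFam S ηq) (expFam S ηk) L 0 θ • S θ ∂ν = meanParam ν S ηq := by
    simp [tilted, meanParam]
  rw [ContinuousWithinAt, h0] at hcont
  have hsmall : ∀ᶠ α in 𝓝[>] (0 : ℝ), 0 < α ∧ α ≤ β / 2 := Ioc_mem_nhdsGT (half_pos hβ)
  filter_upwards [hcont.eventually (eventually_exists_meanParam_eq hmin hS h), hsmall]
    with α hex hα ξ
  have hint := integrable_tilted_smul hS h hL hLm hLpos hα.1 hα.2 ht
  have hmem := Function.invFunOn_mem hex
  have heq := Function.invFunOn_eq hex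
  refine ⟨fun hξ => ?_, ?_⟩
  · exact eq_of_meanParam_eq hmin hξ.2.1 hmem.2 (hξ.2.2.trans heq.symm)
  · rintro rfl
    exact ⟨hint, hmem.2, heq⟩

/-- For small `α` the power-EP step is well defined, and it moves both natural parameters by `ρ`
times a vector that converges as `α → 0⁺`. -/
lemma exists_tendsto_isPEPStep_iff (hmin : LinIndepStat ν S) (hS : AEStronglyMeasurable S ν)
    (h : HasExpMoment ν S (fun _ => (1 : ℝ)) ηq δ)
    (hL : HasExpMoment ν S (fun θ => Real.log (L θ)) ηq δ') (hLm : AEMeasurable L ν)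
    (hLpos : ∀ᵐ θ ∂ν, 0 < L θ) {β : ℝ} (hβ : 0 < β)
    (ht : Integrable (tilted (expFam S ηq) (expFam S ηk) L β) ν) :
    ∃ w : ℝ → V,
      Tendsto w (𝓝[>] 0) (𝓝 (∇ (expLogLikOfMean ν S L) (meanParam ν S ηq) - ηk)) ∧
      ∀ ρ : ℝ, ∀ᶠ α in 𝓝[>] (0 : ℝ), ∀ ηq' ηk' : V,
        IsPEPStep ν S L ρ α ηq ηk ηq' ηk' ↔ ηq' = ηq + ρ • w α ∧ ηk' = ηk + ρ • w α := by
  obtain ⟨M, hM⟩ := exists_momentEquiv hmin hS h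
  rw [(hasGradientAt_expLogLikOfMean hmin hS h hL hM).gradient]
  set G : ℝ → V := fun α => ∫ θ, tilted (expFam S ηq) (expFam S ηk) L α θ • S θ ∂ν with hG
  set ψ := Function.invFunOn (meanParam ν S) (meanDomain ν S) with hψ
  have h0 : G 0 = meanParam ν S ηq := by simp [hG, tilted, meanParam]
  have hψ0 : ψ (G 0) = ηq := by
    rw [h0]
    exact invFunOn_meanParam hmin (eventually_mem_meanDomain hS h).self_of_nhds
  have hd : HasFDerivAt ψ (M.symm : V →L[ℝ] V) (G 0) := by
    rw [h0]; exact hasFDerivAt_invFunOn_meanParam hmin hS h hM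
  have hslope := hd.comp_hasDerivWithinAt (0 : ℝ)
    (hasDerivWithinAt_integral_tilted hS h hL hLm hLpos hβ ht)
  have hval : (M.symm : V →L[ℝ] V)
      ((∫ θ, expFam S ηq θ • Real.log (L θ) • S θ ∂ν) - momentOp ν S ηq ηk) =
      M.symm (∫ θ, expFam S ηq θ • Real.log (L θ) • S θ ∂ν) - ηk := by
    rw [map_sub, ← hM]; simp
  rw [hval, hasDerivWithinAt_iff_tendsto_slope' (by simp)] at hslope
  refine ⟨_, hslope, fun ρ => ?_⟩
  filter_upwards [eventually_isMomentProj_iff hmin hS h hL hLm hLpos hβ ht,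
    self_mem_nhdsWithin] with α hα hpos ηq' ηk'
  have hα0 : α ≠ 0 := (Set.mem_Ioi.1 hpos).ne'
  -- The key identity: since `ψ (G 0) = ηq`, the weights `1 - ρ / α` and `ρ / α` produce a
  -- difference quotient.
  have e : (1 - ρ / α) • ηq + (ρ / α) • ψ (G α) = ηq + ρ • slope (ψ ∘ G) 0 α := by
    rw [slope_def_module, Function.comp_apply, Function.comp_apply, hψ0, sub_zero, smul_smul,
      ← div_eq_mul_inv]
    module
  rw [isPEPStep_iff hmin]
  simp only [hα, exists_eq_left]
  change (ηq' = (1 - ρ / α) • ηq + (ρ / α) • ψ (G α) ∧ _) ↔ _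
  rw [e]
  refine and_congr_right fun hq' => ?_
  rw [hq', add_sub_cancel_left, add_comm]

omit [FiniteDimensional ℝ V] [CompleteSpace V] in
lemma HasExpMoment.of_expFam_eq {f : Θ → ℝ} (h : HasExpMoment ν S f η δ) {κ : ℝ}
    (hκ : ∀ θ, expFam S η' θ = κ * expFam S η θ) : HasExpMoment ν S f η' δ :=
  ⟨h.pos, h.aesm, (h.integrable.const_mul κ).congr (ae_of_all _ fun θ => by
    simp only [hκ]; ring)⟩

/-- The derivative of `∫ q log L` with respect to the mean parameter does not depend on the
normalisation of `q`. -/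
lemma gradient_expLogLikOfMean_eq_of_expFam_eq (hmin : LinIndepStat ν S)
    (hS : AEStronglyMeasurable S ν) (h : HasExpMoment ν S (fun _ => (1 : ℝ)) η δ)
    (hL : HasExpMoment ν S (fun θ => Real.log (L θ)) η δ') {κ : ℝ}
    (hκ : ∀ θ, expFam S η' θ = κ * expFam S η θ) :
    ∇ (expLogLikOfMean ν S L) (meanParam ν S η') =
      ∇ (expLogLikOfMean ν S L) (meanParam ν S η) := by
  obtain ⟨M, hM⟩ := exists_momentEquiv hmin hS h
  have h' := h.of_expFam_eq hκ
  obtain ⟨M', hM'⟩ := exists_momentEquiv hmin hS h'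
  rw [(hasGradientAt_expLogLikOfMean hmin hS h hL hM).gradient,
    (hasGradientAt_expLogLikOfMean hmin hS h' (hL.of_expFam_eq hκ) hM').gradient,
    M'.symm_apply_eq]
  -- Rescaling multiplies both the second-moment operator and the right-hand side by `κ`, so the
  -- solution of the linear system is unchanged.
  have e : ∀ x, M' x = κ • M x := fun x => by
    have e₁ : M' x = momentOp ν S η' x := by rw [← hM']; rfl
    have e₂ : M x = momentOp ν S η x := by rw [← hM]; rfl
    rw [e₁, e₂, momentOp_apply hS h', momentOp_apply hS h, ← integral_smul]
    simp only [hκ, mul_smul]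
  rw [e, M.apply_symm_apply, ← integral_smul]
  simp only [hκ, mul_smul]

end Step

/-! ### Passage to normalised members -/

section Normalised

variable {Θ : Type*} [MeasurableSpace Θ] {ν : Measure Θ}
variable {E : Type*} [NormedAddCommGroup E] [InnerProductSpace ℝ E]
variable {T : Θ → E} {L : Θ → ℝ}

omit [MeasurableSpace Θ] in
lemma expFam_augStat (T : Θ → E) (η : WithLp 2 (ℝ × E)) (θ : Θ) :
    expFam (augStat T) η θ = Real.exp η.fst * expFam T η.snd θ := by
  rw [expFam, expFam, ← Real.exp_add, WithLp.prod_inner_apply]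
  simp [augStat]

omit [InnerProductSpace ℝ E] in
lemma aestronglyMeasurable_augStat (hT : AEStronglyMeasurable T ν) :
    AEStronglyMeasurable (augStat T) ν :=
  (WithLp.prod_continuous_toLp 2 ℝ E).comp_aestronglyMeasurable
    ((aestronglyMeasurable_const (b := (1 : ℝ))).prodMk hT)

/-- The natural parameter, in the augmented family, of the normalised member. -/
def normParam (ν : Measure Θ) (T : Θ → E) (η : E) : WithLp 2 (ℝ × E) :=
  WithLp.toLp 2 (-logPartition ν T η, η)

lemma expFam_normParam (ν : Measure Θ) (T : Θ → E) (η : E) (θ : Θ) :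
    expFam (augStat T) (normParam ν T η) θ =
      Real.exp (-logPartition ν T η) * expFam T η θ :=
  expFam_augStat T _ θ

lemma normFam_eq (ν : Measure Θ) (T : Θ → E) (η : E) :
    normFam ν T η = expFam (augStat T) (normParam ν T η) := by
  funext θ
  rw [expFam_normParam, normFam, expFam, ← Real.exp_add, neg_add_eq_sub]

lemma normExpLogLik_eq (ν : Measure Θ) (T : Θ → E) (L : Θ → ℝ) (η : E) :
    normExpLogLik ν T L η = expLogLik ν (augStat T) L (normParam ν T η) := by
  rw [normExpLogLik, expLogLik, normFam_eq]

omit [MeasurableSpace Θ] in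
lemma expFam_smul_augStat (T : Θ → E) (η : WithLp 2 (ℝ × E)) (θ : Θ) :
    expFam (augStat T) η θ • augStat T θ =
      WithLp.toLp 2 (expFam (augStat T) η θ, expFam (augStat T) η θ • T θ) := by
  rw [augStat, ← WithLp.toLp_smul, Prod.smul_mk, smul_eq_mul, mul_one]

lemma mem_meanDomain_augStat {η : WithLp 2 (ℝ × E)} :
    η ∈ meanDomain ν (augStat T) ↔ η.snd ∈ meanDomain ν T := by
  have h₁ : Integrable (expFam (augStat T) η) ν ↔ Integrable (expFam T η.snd) ν := by
    have : expFam (augStat T) η = fun θ => Real.exp η.fst * expFam T η.snd θ :=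
      funext (expFam_augStat T η)
    rw [this, integrable_const_mul_iff (Real.exp_pos _).ne'.isUnit]
  have h₂ : Integrable (fun θ => expFam (augStat T) η θ • T θ) ν ↔
      Integrable (fun θ => expFam T η.snd θ • T θ) ν := by
    simp only [expFam_augStat, mul_smul]
    exact integrable_smul_iff (Real.exp_pos _).ne' _
  constructor
  · rintro ⟨ha, hb⟩
    refine ⟨h₁.1 ha, h₂.1 (((WithLp.sndL 2 ℝ ℝ E).integrable_comp hb).congr
      (ae_of_all _ fun θ => ?_))⟩
    simp only [expFam_smul_augStat]
    rfl
  · rintro ⟨ha, hb⟩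
    refine ⟨h₁.2 ha, (((WithLp.prodContinuousLinearEquiv 2 ℝ ℝ E).symm :
      ℝ × E →L[ℝ] WithLp 2 (ℝ × E)).integrable_comp ((h₁.2 ha).prodMk (h₂.2 hb))).congr
      (ae_of_all _ fun θ => ?_)⟩
    simp only [expFam_smul_augStat]
    rfl

/-- The constant statistic records the total mass, so members of mass one are those with mean
parameter `(1, m)`. -/
lemma meanParam_augStat [CompleteSpace E] {η : WithLp 2 (ℝ × E)}
    (hη : η ∈ meanDomain ν (augStat T)) :
    meanParam ν (augStat T) η = WithLp.toLp 2
      (∫ θ, expFam (augStat T) η θ ∂ν, ∫ θ, expFam (augStat T) η θ • T θ ∂ν) := by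
  have h₁ := (WithLp.fstL 2 ℝ ℝ E).integral_comp_comm hη.2
  have h₂ := (WithLp.sndL 2 ℝ ℝ E).integral_comp_comm hη.2
  simp only [expFam_smul_augStat] at h₁ h₂
  have h₃ : meanParam ν (augStat T) η = WithLp.toLp 2
      (WithLp.fstL 2 ℝ ℝ E (meanParam ν (augStat T) η),
        WithLp.sndL 2 ℝ ℝ E (meanParam ν (augStat T) η)) := rfl
  rw [h₃, meanParam]
  simp only [expFam_smul_augStat]
  rw [← h₁, ← h₂]
  rfl

lemma neZero_of_linIndepStat (hmin : LinIndepStat ν (augStat T)) : NeZero ν := by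
  refine ⟨?_⟩
  rintro rfl
  have := congrArg WithLp.fst (hmin (WithLp.toLp 2 (1, 0)) (by simp))
  exact one_ne_zero this

lemma integral_expFam_pos [NeZero ν] {η : E} (h : Integrable (expFam T η) ν) :
    0 < ∫ θ, expFam T η θ ∂ν :=
  integral_exp_pos h

lemma meanParam_normParam [CompleteSpace E] [NeZero ν] {η : E} (hη : η ∈ meanDomain ν T) :
    meanParam ν (augStat T) (normParam ν T η) = WithLp.toLp 2 (1, normMeanParam ν T η) := by
  have hmem : normParam ν T η ∈ meanDomain ν (augStat T) := mem_meanDomain_augStat.2 hη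
  rw [meanParam_augStat hmem, normMeanParam, normFam_eq]
  congr 2
  have hZ := integral_expFam_pos hη.1
  simp only [expFam_normParam, integral_const_mul, logPartition, Real.exp_neg, Real.exp_log hZ]
  exact inv_mul_cancel₀ hZ.ne'

/-- A member of the augmented family of mass one is the normalised member. -/
lemma eq_normParam [NeZero ν] {ξ : WithLp 2 (ℝ × E)} (hξ : Integrable (expFam T ξ.snd) ν)
    (hmass : ∫ θ, expFam (augStat T) ξ θ ∂ν = 1) : ξ = normParam ν T ξ.snd := by
  have hZ := integral_expFam_pos hξ
  simp only [expFam_augStat, integral_const_mul] at hmass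
  have hfst : ξ.fst = -logPartition ν T ξ.snd := by
    have := congrArg Real.log hmass
    rw [Real.log_mul (Real.exp_pos _).ne' hZ.ne', Real.log_exp, Real.log_one] at this
    rw [logPartition]
    linarith
  rw [normParam, ← hfst]
  rfl

lemma eq_of_normMeanParam_eq [CompleteSpace E] (hmin : LinIndepStat ν (augStat T)) {η₁ η₂ : E}
    (h₁ : η₁ ∈ meanDomain ν T) (h₂ : η₂ ∈ meanDomain ν T)
    (h : normMeanParam ν T η₁ = normMeanParam ν T η₂) : η₁ = η₂ := by
  have := neZero_of_linIndepStat hmin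
  have hmem : ∀ {η}, η ∈ meanDomain ν T → normParam ν T η ∈ meanDomain ν (augStat T) :=
    fun hη => mem_meanDomain_augStat.2 hη
  exact congrArg WithLp.snd (eq_of_meanParam_eq hmin (hmem h₁).2 (hmem h₂).2
    (by rw [meanParam_normParam h₁, meanParam_normParam h₂, h]))

lemma invFunOn_normMeanParam [CompleteSpace E] (hmin : LinIndepStat ν (augStat T)) {η : E}
    (hη : η ∈ meanDomain ν T) :
    Function.invFunOn (normMeanParam ν T) (meanDomain ν T) (normMeanParam ν T η) = η := by
  have hex : ∃ ξ ∈ meanDomain ν T, normMeanParam ν T ξ = normMeanParam ν T η := ⟨η, hη, rfl⟩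
  exact eq_of_normMeanParam_eq hmin (Function.invFunOn_mem hex) hη (Function.invFunOn_eq hex)

/-- If `(1, m)` is a mean parameter of the augmented family, the normalised and the unnormalised
expected log-likelihoods agree there. -/
lemma normExpLogLikOfMean_eq [CompleteSpace E] (hmin : LinIndepStat ν (augStat T)) {m : E}
    (hm : ∃ ξ ∈ meanDomain ν (augStat T), meanParam ν (augStat T) ξ = WithLp.toLp 2 (1, m)) :
    normExpLogLikOfMean ν T L m = expLogLikOfMean ν (augStat T) L (WithLp.toLp 2 (1, m)) := by
  have := neZero_of_linIndepStat hmin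
  obtain ⟨ξ, hξ, hξm⟩ := hm
  have hsnd := mem_meanDomain_augStat.1 hξ
  have hmass : ∫ θ, expFam (augStat T) ξ θ ∂ν = 1 := by
    rw [meanParam_augStat hξ] at hξm
    exact congrArg WithLp.fst hξm
  have hnorm := eq_normParam hsnd.1 hmass
  have hm' : m = normMeanParam ν T ξ.snd := by
    rw [hnorm, meanParam_normParam hsnd] at hξm
    exact (congrArg WithLp.snd hξm).symm
  rw [normExpLogLikOfMean, expLogLikOfMean, ← hξm, invFunOn_meanParam hmin hξ, hm',
    invFunOn_normMeanParam hmin hsnd, normExpLogLik_eq, ← hnorm]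

/-- Restriction to the affine slice `{1} × E` projects the gradient orthogonally onto `E`. -/
lemma hasGradientAt_comp_toLp_one [CompleteSpace E] {f : WithLp 2 (ℝ × E) → ℝ}
    {g : WithLp 2 (ℝ × E)} {m : E} (hf : HasGradientAt f g (WithLp.toLp 2 (1, m))) :
    HasGradientAt (fun x => f (WithLp.toLp 2 (1, x))) g.snd m := by
  have h₁ : HasFDerivAt (fun x : E => (WithLp.toLp 2 ((1 : ℝ), x) : WithLp 2 (ℝ × E)))
      (((WithLp.prodContinuousLinearEquiv 2 ℝ ℝ E).symm : ℝ × E →L[ℝ] WithLp 2 (ℝ × E)).comp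
        (ContinuousLinearMap.inr ℝ ℝ E)) m :=
    ((WithLp.prodContinuousLinearEquiv 2 ℝ ℝ E).symm :
      ℝ × E →L[ℝ] WithLp 2 (ℝ × E)).hasFDerivAt.comp m (hasFDerivAt_prodMk_right 1 m)
  refine hasGradientAt_iff_hasFDerivAt.2 ((hf.hasFDerivAt.comp m h₁).congr_fderiv ?_)
  ext x
  simp [WithLp.prod_inner_apply]

/-- The derivative of `E_q[log L]` with respect to the mean parameter of the normalised member is
the component along `T` of the derivative for the unnormalised one. -/
lemma hasGradientAt_normExpLogLikOfMean [FiniteDimensional ℝ E] [CompleteSpace E]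
    (hT : AEStronglyMeasurable T ν) (hmin : LinIndepStat ν (augStat T))
    {η : WithLp 2 (ℝ × E)} {δ δ' : ℝ}
    (h : HasExpMoment ν (augStat T) (fun _ => (1 : ℝ)) η δ)
    (hL : HasExpMoment ν (augStat T) (fun θ => Real.log (L θ)) η δ') :
    HasGradientAt (normExpLogLikOfMean ν T L)
      (∇ (expLogLikOfMean ν (augStat T) L) (meanParam ν (augStat T) η)).snd
      (normMeanParam ν T η.snd) := by
  have := neZero_of_linIndepStat hmin
  have hS := aestronglyMeasurable_augStat hT
  have hη := mem_meanDomain_augStat.1 (eventually_mem_meanDomain hS h).self_of_nhds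
  have hκ : ∀ θ, expFam (augStat T) (normParam ν T η.snd) θ =
      Real.exp (-logPartition ν T η.snd - η.fst) * expFam (augStat T) η θ := fun θ => by
    rw [expFam_augStat, expFam_augStat, ← mul_assoc, ← Real.exp_add, sub_add_cancel]
    rfl
  have h' := h.of_expFam_eq hκ
  obtain ⟨M, hM⟩ := exists_momentEquiv hmin hS h'
  have hg := hasGradientAt_expLogLikOfMean hmin hS h' (hL.of_expFam_eq hκ) hM
  rw [← hg.gradient, gradient_expLogLikOfMean_eq_of_expFam_eq hmin hS h hL hκ,
    meanParam_normParam hη] at hg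
  refine (hasGradientAt_comp_toLp_one hg).congr_of_eventuallyEq ?_
  -- For `m` near the given mean, `(1, m)` is still attained; only there do the two functions of `m`
  -- have to agree.
  have hex := eventually_exists_meanParam_eq hmin hS h'
  rw [meanParam_normParam hη] at hex
  have hcont : Continuous fun x : E => (WithLp.toLp 2 ((1 : ℝ), x) : WithLp 2 (ℝ × E)) :=
    (WithLp.prod_continuous_toLp 2 ℝ E).comp (by fun_prop)
  exact (hcont.continuousAt.eventually hex).mono fun m hm => normExpLogLikOfMean_eq hmin hm

end Normalised

end PowerEP

end

/-! ### The limit of the step as `α → 0⁺` -/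

theorem mainTheorem4 {Θ : Type*} [MeasurableSpace Θ] (ν : Measure Θ) {d : ℕ}
    (T : Θ → EuclideanSpace ℝ (Fin d)) (hT : Measurable T)
    (hmin : PowerEP.LinIndepStat ν (PowerEP.augStat T))
    (L : Θ → ℝ) (hL : Measurable L) (hLpos : ∀ᵐ θ ∂ν, 0 < L θ)
    (ρ : ℝ) (ηq ηk : WithLp 2 (ℝ × EuclideanSpace ℝ (Fin d)))
    -- the current posterior is in the interior of the natural parameter space
    (hq : ηq.snd ∈ interior (PowerEP.natDomain ν T))
    -- the expected log-likelihood is finite near the current posterior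
    (hlog : ∀ᶠ η in 𝓝 ηq.snd,
      Integrable (fun θ => PowerEP.expFam T η θ * Real.log (L θ)) ν)
    -- some tilted distribution has finite mass
    (htilt : ∃ α : ℝ, 0 < α ∧
      Integrable (PowerEP.tilted (PowerEP.expFam (PowerEP.augStat T) ηq)
        (PowerEP.expFam (PowerEP.augStat T) ηk) L α) ν) :
    -- for small `α > 0` the power-EP step is well defined
    (∀ᶠ α in 𝓝[>] (0 : ℝ),
      ∃! η' : WithLp 2 (ℝ × EuclideanSpace ℝ (Fin d)) × WithLp 2 (ℝ × EuclideanSpace ℝ (Fin d)),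
        PowerEP.IsPEPStep ν (PowerEP.augStat T) L ρ α ηq ηk η'.1 η'.2) ∧
    -- the derivatives with respect to the mean parameters exist
    DifferentiableAt ℝ (PowerEP.expLogLikOfMean ν (PowerEP.augStat T) L)
      (PowerEP.meanParam ν (PowerEP.augStat T) ηq) ∧
    DifferentiableAt ℝ (PowerEP.normExpLogLikOfMean ν T L)
      (PowerEP.normMeanParam ν T ηq.snd) ∧
    -- the result of the step converges to the damped fixed-point update
    ∀ ηq' ηk' : ℝ → WithLp 2 (ℝ × EuclideanSpace ℝ (Fin d)),
      (∀ᶠ α in 𝓝[>] (0 : ℝ),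
        PowerEP.IsPEPStep ν (PowerEP.augStat T) L ρ α ηq ηk (ηq' α) (ηk' α)) →
      -- in the augmented natural parameters, with the unnormalised posterior
      Tendsto ηk' (𝓝[>] 0)
        (𝓝 ((1 - ρ) • ηk + ρ • ∇ (PowerEP.expLogLikOfMean ν (PowerEP.augStat T) L)
          (PowerEP.meanParam ν (PowerEP.augStat T) ηq))) ∧
      Tendsto ηq' (𝓝[>] 0)
        (𝓝 (ηq - ηk + ((1 - ρ) • ηk +
          ρ • ∇ (PowerEP.expLogLikOfMean ν (PowerEP.augStat T) L)
            (PowerEP.meanParam ν (PowerEP.augStat T) ηq)))) ∧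
      -- in the natural parameters proper, with the normalised posterior
      Tendsto (fun α => (ηk' α).snd) (𝓝[>] 0)
        (𝓝 ((1 - ρ) • ηk.snd + ρ • ∇ (PowerEP.normExpLogLikOfMean ν T L)
          (PowerEP.normMeanParam ν T ηq.snd))) ∧
      Tendsto (fun α => (ηq' α).snd) (𝓝[>] 0)
        (𝓝 (ηq.snd - ηk.snd + ((1 - ρ) • ηk.snd +
          ρ • ∇ (PowerEP.normExpLogLikOfMean ν T L)
            (PowerEP.normMeanParam ν T ηq.snd)))) := by
  have hTm : AEStronglyMeasurable T ν := hT.aestronglyMeasurable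
  have hS := PowerEP.aestronglyMeasurable_augStat hTm
  have hsnd : Tendsto (fun η : WithLp 2 (ℝ × EuclideanSpace ℝ (Fin d)) => η.snd) (𝓝 ηq)
      (𝓝 ηq.snd) := (WithLp.sndL 2 ℝ ℝ (EuclideanSpace ℝ (Fin d))).continuous.continuousAt
  -- The first augmented coordinate only contributes a constant factor, so the local integrability
  -- hypotheses on `T` lift to the augmented family.
  obtain ⟨δ, h⟩ := PowerEP.exists_hasExpMoment hS (f := fun _ => (1 : ℝ))
    aestronglyMeasurable_const (η := ηq) <| by
      filter_upwards [hsnd.eventually (mem_interior_iff_mem_nhds.1 hq)] with η hη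
      simp only [PowerEP.expFam_augStat, smul_eq_mul, mul_one]
      exact Integrable.const_mul hη _
  obtain ⟨δ', hL'⟩ := PowerEP.exists_hasExpMoment hS (f := fun θ => Real.log (L θ))
    hL.log.aestronglyMeasurable (η := ηq) <| by
      filter_upwards [hsnd.eventually hlog] with η hη
      simp only [PowerEP.expFam_augStat, smul_eq_mul, mul_assoc]
      exact hη.const_mul _
  obtain ⟨β, hβ, ht⟩ := htilt
  obtain ⟨w, hw, hstep⟩ :=
    PowerEP.exists_tendsto_isPEPStep_iff hmin hS h hL' hL.aemeasurable hLpos hβ ht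
  obtain ⟨M, hM⟩ := PowerEP.exists_momentEquiv hmin hS h
  have hnorm := PowerEP.hasGradientAt_normExpLogLikOfMean hTm hmin h hL'
  refine ⟨?_, (PowerEP.hasGradientAt_expLogLikOfMean hmin hS h hL' hM).differentiableAt,
    hnorm.differentiableAt, fun ηq' ηk' h' => ?_⟩
  · filter_upwards [hstep ρ] with α hα
    exact ⟨(ηq + ρ • w α, ηk + ρ • w α), (hα _ _).2 ⟨rfl, rfl⟩,
      fun η' hη' => Prod.ext ((hα _ _).1 hη').1 ((hα _ _).1 hη').2⟩
  · rw [hnorm.gradient]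
    set g := ∇ (PowerEP.expLogLikOfMean ν (PowerEP.augStat T) L)
      (PowerEP.meanParam ν (PowerEP.augStat T) ηq)
    have hupd := (hstep ρ).and h'
    have hk : Tendsto ηk' (𝓝[>] 0) (𝓝 ((1 - ρ) • ηk + ρ • g)) := by
      have e : (1 - ρ) • ηk + ρ • g = ηk + ρ • (g - ηk) := by module
      rw [e]
      exact ((hw.const_smul ρ).const_add ηk).congr'
        (hupd.mono fun α hα => ((hα.1 _ _).1 hα.2).2.symm)
    have hq' : Tendsto ηq' (𝓝[>] 0) (𝓝 (ηq - ηk + ((1 - ρ) • ηk + ρ • g))) := by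
      have e : ηq - ηk + ((1 - ρ) • ηk + ρ • g) = ηq + ρ • (g - ηk) := by module
      rw [e]
      exact ((hw.const_smul ρ).const_add ηq).congr'
        (hupd.mono fun α hα => ((hα.1 _ _).1 hα.2).1.symm)
    have hproj := (WithLp.sndL 2 ℝ ℝ (EuclideanSpace ℝ (Fin d))).continuous
    exact ⟨hk, hq', (hproj.tendsto _).comp hk, (hproj.tendsto _).comp hq'⟩
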